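/- Let $(\mathcal M,g)$ be a connected, compact, smooth $p$-dimensional Riemannian manifold without boundary, $p\ge 1$, with geodesic distance $d$ and Riemannian volume measure $\mathrm{vol}_{\mathcal M}$. For Borel probability measures $\mu,\nu$ on $\mathcal M$, an optimal transport map from $\mu$ to $\nu$ is a measurable map $T_\star:\mathcal M\to\mathcal M$ with $(T_\star)_\#\mu=\nu$ which minimizes $\int_{\mathcal M}\tfrac12 d(x,T(x))^2\,\mathrm d\mu(x)$ among all measurable $T$ with $T_\#\mu=\nu$. For measurable $T,S:\mathcal M\to\mathcal M$ put $$\mathrm{RMSE}_\mu(T,S):=\Bigl(\int_{\mathcal M} d(T(x),S(x))^2\,\mathrm d\mu(x)\Bigr)^{1/2},$$ and for an integer $m\ge 1$ let $\mathsf D_m(\mu)$ be the set of measurable maps $T:\mathcal M\to\mathcal M$ whose pushforward $T_\#\mu$ is supported on at most $m$ points, i.e. $\#\,\mathrm{supp}(T_\#\mu)\le m$. **Theorem.** Let $\nu$ be a Borel probability measure on $\mathcal M$ with $\nu\ll\mathrm{vol}_{\mathcal M}$. There exists a constant $C>0$, depending only on $\mathcal M$ and $\nu$, such that for every Borel probability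 measure $\mu\ll\mathrm{vol}_{\mathcal M}$, every optimal transport map $T_\star$ from $\mu$ to $\nu$, and every integer $m\ge 1$, $$\inf_{T\in\mathsf D_m(\mu)}\mathrm{RMSE}_\mu(T,T_\star)\ \ge\ C\,m^{-1/p}.$$ In particular, for every $\delta>0$, if some $T\in\mathsf D_m(\mu)$ satisfies $\mathrm{RMSE}_\mu(T,T_\star)\le\delta$, then $m\ge (C/\delta)^p$. -/

import Mathlib

open MeasureTheory Bundle Manifold
open scoped ContDiff

noncomputable section

namespace RiemannianOT

section Volume

variable (p : ℕ) {M : Type*} [TopologicalSpace M] [ChartedSpace (EuclideanSpace ℝ (Fin p)) M]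
  [RiemannianBundle (fun x : M => TangentSpace (𝓡 p) x)]

/-- The coordinate vector `∂/∂xᵢ` of the chart `φ = chartAt x₀`, at the point with coordinates
`y`: the image of the `i`-th standard basis vector under the differential of `φ⁻¹` at `y`. -/
def coordVector (x₀ : M) (y : EuclideanSpace ℝ (Fin p)) (i : Fin p) :
    TangentSpace (𝓡 p) ((chartAt (EuclideanSpace ℝ (Fin p)) x₀).symm y) :=
  mfderiv (𝓡 p) (𝓡 p) (chartAt (EuclideanSpace ℝ (Fin p)) x₀).symm y
    (EuclideanSpace.single i (1 : ℝ))

/-- The matrix `(gᵢⱼ)` of the Riemannian metric in the chart `chartAt x₀`,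
`gᵢⱼ(y) = g(∂/∂xᵢ, ∂/∂xⱼ)`. -/
def metricMatrix (x₀ : M) (y : EuclideanSpace ℝ (Fin p)) : Matrix (Fin p) (Fin p) ℝ :=
  Matrix.of fun i j => inner ℝ (coordVector p x₀ y i) (coordVector p x₀ y j)

variable [MeasurableSpace M]

/-- The Riemannian volume of the domain `U` of the chart `φ = chartAt x₀`, as a measure on the
manifold carried by `U`: it gives `A` the mass `∫_{φ(A ∩ U)} √det(gᵢⱼ(y)) dy`. -/
def chartVolume (x₀ : M) : Measure M :=
  ((volume.restrict (chartAt (EuclideanSpace ℝ (Fin p)) x₀).target).withDensity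
    (fun y => ENNReal.ofReal (Real.sqrt (metricMatrix p x₀ y).det))).map
      (chartAt (EuclideanSpace ℝ (Fin p)) x₀).symm

variable (M) in
/-- The Riemannian volume measure. The chart volumes agree on overlaps of chart domains, and the
volume measure is the one measure that restricts to each of them; on a second countable manifold
this is their least upper bound in the lattice of measures. -/
def riemannianVolume : Measure M :=
  ⨆ x₀ : M, chartVolume p x₀

end Volume

section Maps

variable {M : Type*} [MetricSpace M] [MeasurableSpace M]

/-- `T` is an optimal transport map from `μ` to `ν` for the cost `c(x, y) = d(x, y)² / 2`: a
minimizer of the Monge problem. -/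
structure IsOptimalTransportMap (μ ν : Measure M) (T : M → M) : Prop where
  measurable : Measurable T
  map_eq : μ.map T = ν
  cost_le : ∀ S : M → M, Measurable S → μ.map S = ν →
    ∫ x, (1 / 2 : ℝ) * dist x (T x) ^ 2 ∂μ ≤ ∫ x, (1 / 2 : ℝ) * dist x (S x) ^ 2 ∂μ

/-- The root-mean-square error `(∫ d(T x, S x)² dμ(x))^{1/2}`. -/
def rmse (μ : Measure M) (T S : M → M) : ℝ :=
  Real.sqrt (∫ x, dist (T x) (S x) ^ 2 ∂μ)

/-- The discrete-output maps: measurable maps whose pushforward of `μ` has a support of at most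
`m` points. -/
def discreteOutputMaps (m : ℕ) (μ : Measure M) : Set (M → M) :=
  {T | Measurable T ∧ (μ.map T).support.encard ≤ m}

end Maps

end RiemannianOT

end

open Metric Set Filter
open scoped ENNReal NNReal Topology

namespace MeasureTheory.Measure

variable {α ι : Type*} [MeasurableSpace α]

/-! The error is bounded below by the quantization error of `ν`. For a.e. `x`, `T x` lies in a set
of at most `m` points, so `dist (T x) (S x)` is at least the distance from `S x` to that set, and `S
x` has law `ν` (`mul_sqrt_le_rmse`). In a Lipschitz chart, `m` balls of radius `κ m^(-1/p)` map into
Euclidean balls of total volume at most `t^p vol(B)`, independent of `m`. For small `t`, absolute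
continuity leaves at least half of the mass of the chart ball uncovered
(`exists_pos_le_measure_far`). -/

/-- Restricting the supremum to `sᶜ` still gives an upper bound of the family. -/
theorem iSup_apply_eq_zero {μ : ι → Measure α} {s : Set α} (hs : MeasurableSet s)
    (h : ∀ i, μ i s = 0) : (⨆ i, μ i) s = 0 := by
  have hle : ⨆ i, μ i ≤ (⨆ i, μ i).restrict sᶜ := by
    refine iSup_le fun i => ?_
    have hi : (μ i).restrict sᶜ = μ i :=
      restrict_eq_self_of_ae_mem (measure_eq_zero_iff_ae_notMem.1 (h i))
    rw [← hi]
    exact restrict_mono subset_rfl (le_iSup μ i)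
  have := hle s
  rwa [restrict_apply hs, inter_compl_self, measure_empty, nonpos_iff_eq_zero] at this

theorem AbsolutelyContinuous.exists_pos_measure_lt {μ ν : Measure α} [IsFiniteMeasure μ]
    [SigmaFinite ν] (h : μ ≪ ν) {ε : ℝ≥0∞} (hε : ε ≠ 0) :
    ∃ δ > 0, ∀ s, MeasurableSet s → ν s < δ → μ s < ε := by
  obtain ⟨δ, hδ, H⟩ := exists_pos_setLIntegral_lt_of_measure_lt
    (μ := ν) (f := μ.rnDeriv ν) (lintegral_rnDeriv_lt_top μ ν).ne hε
  refine ⟨δ, hδ, fun s hs hsδ => ?_⟩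
  have := H s hsδ
  rwa [← withDensity_apply _ hs, withDensity_rnDeriv_eq μ ν h] at this

end MeasureTheory.Measure

namespace RiemannianOT

/-! ### Quantization bound for absolutely continuous measures -/

section Quantization

variable {M E : Type*} [MetricSpace M] [MeasurableSpace M] [BorelSpace M]
  [NormedAddCommGroup E] [NormedSpace ℝ E] [FiniteDimensional ℝ E] [MeasurableSpace E]
  [BorelSpace E]

theorem exists_pos_le_measure_far {ν : Measure M} [IsFiniteMeasure ν] {U : Set M}
    (hU : MeasurableSet U) (hνU : ν U ≠ 0) {φ : M → E} {C : ℝ≥0} (hφ : LipschitzOnWith C φ U)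
    (vol : Measure E) [vol.IsAddHaarMeasure] (hac : (ν.restrict U).map φ ≪ vol)
    (hE : Module.finrank ℝ E ≠ 0) :
    ∃ κ ε : ℝ, 0 < κ ∧ 0 < ε ∧ ∀ m : ℕ, 1 ≤ m → ∀ S : Set M, S.encard ≤ m →
      ε ≤ ν.real {y | ∀ s ∈ S, κ * (m : ℝ) ^ (-(1 / (Module.finrank ℝ E : ℝ))) ≤ dist s y} := by
  classical
  set p := Module.finrank ℝ E
  set a := ν U
  have hatop : a ≠ ⊤ := measure_ne_top ν U
  obtain ⟨δ, hδ, hδ'⟩ := hac.exists_pos_measure_lt (ε := a / 2) (by simp [hνU])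
  obtain ⟨n, hn, hnδ⟩ := ENNReal.exists_nnreal_pos_mul_lt
    (a := vol (ball 0 1)) (b := δ) measure_ball_lt_top.ne hδ.ne'
  -- The cap at `1` gives `t ^ p ≤ t ≤ n`.
  set t : ℝ≥0 := min n 1
  have ht : 0 < t := lt_min hn one_pos
  have htδ : ENNReal.ofReal ((t : ℝ) ^ p) * vol (ball 0 1) < δ := by
    refine lt_of_le_of_lt ?_ hnδ
    gcongr
    rw [← ENNReal.ofReal_coe_nnreal]
    refine ENNReal.ofReal_le_ofReal ?_
    have h1 : (t : ℝ) ≤ 1 := by exact_mod_cast min_le_right n 1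
    have h2 : (t : ℝ) ≤ n := by exact_mod_cast min_le_left n 1
    exact (pow_le_of_le_one t.2 h1 hE).trans h2
  -- Two points of one ball are within `2 * κ * q`; `C + 1` avoids division by zero.
  set κ : ℝ := t / (2 * (C + 1))
  have hκ : 0 < κ := by positivity
  refine ⟨κ, (a / 2).toReal, hκ, ENNReal.toReal_pos (by simp [hνU])
    (ENNReal.div_ne_top hatop (by simp)), fun m hm S hS => ?_⟩
  have hm0 : (0 : ℝ) < m := by exact_mod_cast hm
  set q : ℝ := (m : ℝ) ^ (-(1 / (p : ℝ)))
  have hq : 0 < q := by positivity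
  have hqp : q ^ p = (m : ℝ)⁻¹ := by
    rw [← Real.rpow_natCast, ← Real.rpow_mul hm0.le, neg_mul, one_div,
      inv_mul_cancel₀ (by exact_mod_cast hE), Real.rpow_neg_one]
  have hSfin : S.Finite := finite_of_encard_le_coe hS
  -- `s` may lie outside `U`, so the Euclidean ball is centred at the image of a point of `U` near
  -- `s`.
  have hcenter : ∀ s : M, ∃ c : E, ∀ y ∈ U, dist s y < κ * q → φ y ∈ closedBall c (t * q) := by
    intro s
    by_cases h : ∃ z ∈ U, dist s z < κ * q
    · obtain ⟨z, hz, hsz⟩ := h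
      refine ⟨φ z, fun y hy hsy => ?_⟩
      rw [mem_closedBall]
      have h1 : dist y z ≤ 2 * (κ * q) := by
        linarith [dist_triangle_left y z s]
      calc dist (φ y) (φ z) ≤ C * dist y z := hφ.dist_le_mul y hy z hz
        _ ≤ (C + 1) * (2 * (κ * q)) := by gcongr; linarith
        _ = t * q := by simp only [κ]; field_simp
    · push Not at h
      exact ⟨0, fun y hy hsy => absurd hsy (not_lt.2 (h y hy))⟩
  choose c hc using hcenter
  set N : Set E := ⋃ s ∈ S, closedBall (c s) (t * q)
  have hN : MeasurableSet N :=
    hSfin.measurableSet_biUnion fun s _ => measurableSet_closedBall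
  have hvol : vol N < δ := by
    refine lt_of_le_of_lt ?_ htδ
    have hN' : N = ⋃ s ∈ hSfin.toFinset, closedBall (c s) (t * q) := by simp [N]
    rw [hN']
    refine (measure_biUnion_finset_le _ _).trans ?_
    simp_rw [Measure.addHaar_closedBall vol _ (by positivity : (0 : ℝ) ≤ t * q)]
    rw [Finset.sum_const, nsmul_eq_mul, ← mul_assoc]
    gcongr
    have hcard : hSfin.toFinset.card ≤ m := by
      rw [hSfin.encard_eq_coe_toFinset_card] at hS
      exact_mod_cast hS
    rw [← ENNReal.ofReal_natCast, ← ENNReal.ofReal_mul (by positivity)]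
    refine ENNReal.ofReal_le_ofReal ?_
    change _ * ((t : ℝ) * q) ^ p ≤ _
    rw [mul_pow, hqp]
    have : (hSfin.toFinset.card : ℝ) ≤ m := by exact_mod_cast hcard
    calc (hSfin.toFinset.card : ℝ) * (t ^ p * (m : ℝ)⁻¹) ≤ m * (t ^ p * (m : ℝ)⁻¹) := by gcongr
      _ = t ^ p := by field_simp
  have hφm : AEMeasurable φ (ν.restrict U) := hφ.continuousOn.aemeasurable hU
  have hlt := hδ' N hN hvol
  rw [Measure.map_apply_of_aemeasurable hφm hN] at hlt
  have hsub : U ⊆ {y | y ∈ U ∧ φ y ∈ N} ∪ {y | ∀ s ∈ S, κ * q ≤ dist s y} := by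
    intro y hy
    by_cases h : ∀ s ∈ S, κ * q ≤ dist s y
    · exact Or.inr h
    · push Not at h
      obtain ⟨s, hs, hsy⟩ := h
      exact Or.inl ⟨hy, mem_iUnion₂.2 ⟨s, hs, hc s y hy hsy⟩⟩
  have hle : a ≤ a / 2 + ν {y | ∀ s ∈ S, κ * q ≤ dist s y} := by
    refine (measure_mono hsub).trans ((measure_union_le _ _).trans ?_)
    gcongr
    refine le_trans ?_ hlt.le
    rw [Measure.restrict_apply' hU]
    exact measure_mono fun y hy => ⟨hy.2, hy.1⟩
  refine ENNReal.toReal_mono (measure_ne_top _ _) ?_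
  have h2 : a / 2 ≠ ⊤ := ENNReal.div_ne_top hatop (by simp)
  rw [← ENNReal.add_le_add_iff_left h2, ENNReal.add_halves]
  exact hle

end Quantization

/-! ### From quantization to the transport error -/

section Rmse

variable {M : Type*} [MetricSpace M] [CompactSpace M] [MeasurableSpace M] [BorelSpace M]

theorem mul_sqrt_le_rmse {μ ν : Measure M} [IsFiniteMeasure μ] {T S : M → M}
    (hT : Measurable T) (hS : Measurable S) (hSν : μ.map S = ν) {r ε : ℝ} (hr : 0 ≤ r)
    (h : ε ≤ ν.real {y | ∀ s ∈ (μ.map T).support, r ≤ dist s y}) :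
    r * Real.sqrt ε ≤ rmse μ T S := by
  have hT_mem : ∀ᵐ x ∂μ, T x ∈ (μ.map T).support :=
    ae_of_ae_map hT.aemeasurable Measure.support_mem_ae
  set V : Set M := {y | ∀ s ∈ (μ.map T).support, r ≤ dist s y}
  have hV : IsClosed V := by
    have : V = ⋂ s ∈ (μ.map T).support, {y | r ≤ dist s y} := by ext; simp [V]
    rw [this]
    exact isClosed_biInter fun s _ => isClosed_le continuous_const (by fun_prop)
  have hSV : MeasurableSet (S ⁻¹' V) := hS hV.measurableSet
  -- Without integrability the Bochner integral would default to `0`.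
  have hint : Integrable (fun x => dist (T x) (S x) ^ 2) μ := by
    refine Integrable.of_bound (C := diam (univ : Set M) ^ 2)
      ((hT.dist hS).pow_const 2).aestronglyMeasurable (ae_of_all _ fun x => ?_)
    rw [Real.norm_of_nonneg (by positivity)]
    gcongr
    exact dist_le_diam_of_mem isCompact_univ.isBounded (mem_univ _) (mem_univ _)
  have hmain : ε * r ^ 2 ≤ ∫ x, dist (T x) (S x) ^ 2 ∂μ := by
    calc ε * r ^ 2 ≤ μ.real (S ⁻¹' V) * r ^ 2 := by
          gcongr
          rwa [← hSν, map_measureReal_apply hS hV.measurableSet] at h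
      _ = ∫ x, (S ⁻¹' V).indicator (fun _ => r ^ 2) x ∂μ := by
          rw [integral_indicator_const _ hSV, smul_eq_mul]
      _ ≤ _ := by
          refine integral_mono_ae ((integrable_const _).indicator hSV) hint ?_
          filter_upwards [hT_mem] with x hx
          by_cases hxV : x ∈ S ⁻¹' V
          · rw [indicator_of_mem hxV]
            have : r ≤ dist (T x) (S x) := hxV _ hx
            gcongr
          · rw [indicator_of_notMem hxV]
            positivity
  rw [rmse]
  refine Real.le_sqrt_of_sq_le ?_
  rcases le_total 0 ε with hε | hε
  · rw [mul_pow, Real.sq_sqrt hε, mul_comm]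
    exact hmain
  · rw [Real.sqrt_eq_zero_of_nonpos hε]
    simpa using integral_nonneg (μ := μ) fun x => sq_nonneg (dist (T x) (S x))

/-- Constant maps qualify. Nonemptiness matters because a real infimum over an empty type is `0`. -/
theorem discreteOutputMaps_nonempty {m : ℕ} (hm : 1 ≤ m) (μ : Measure M) [IsProbabilityMeasure μ] :
    (discreteOutputMaps m μ).Nonempty := by
  obtain ⟨x₀⟩ : Nonempty M := nonempty_of_isProbabilityMeasure μ
  refine ⟨fun _ => x₀, measurable_const, ?_⟩
  have hsub : (μ.map fun _ => x₀).support ⊆ {x₀} := by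
    refine Measure.support_subset_of_isClosed isClosed_singleton ?_
    rw [Measure.map_const, mem_ae_iff, Measure.smul_apply, Measure.dirac_apply' _
      (measurableSet_singleton x₀).compl]
    simp
  refine (encard_le_encard hsub).trans ?_
  rw [encard_singleton]
  exact_mod_cast hm

end Rmse

/-! ### Charts are locally Lipschitz for the Riemannian distance -/

section Chart

attribute [local instance] normedAddCommGroupTangentSpaceVectorSpace
attribute [local instance] normedSpaceTangentSpaceVectorSpace

variable {E : Type*} [NormedAddCommGroup E] [NormedSpace ℝ E]
  {H : Type*} [TopologicalSpace H] (I : ModelWithCorners ℝ E H)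
  {M : Type*} [MetricSpace M] [ChartedSpace H M]
  [RiemannianBundle (fun x : M => TangentSpace I x)]
  [IsManifold I 1 M]

theorem eventually_enorm_mfderiv_extChartAt_apply_le
    [IsContinuousRiemannianBundle E (fun x : M => TangentSpace I x)] (x : M) :
    ∃ C : ℝ≥0, 0 < C ∧ ∀ᶠ y in 𝓝 x, ∀ v : TangentSpace I y,
      ‖(mfderiv I 𝓘(ℝ, E) (extChartAt I x) y v : E)‖ₑ ≤ C * ‖v‖ₑ := by
  obtain ⟨C, hC_pos, hC⟩ := eventually_enorm_mfderiv_extChartAt_lt I x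
  refine ⟨C, hC_pos, ?_⟩
  filter_upwards [hC] with y hy v
  let f : TangentSpace I y →L[ℝ] E := mfderiv I 𝓘(ℝ, E) (extChartAt I x) y
  have hf : ‖f‖ₑ < C := hy
  exact (f.le_opENorm v).trans (mul_le_mul_left hf.le _)

theorem edist_extChartAt_le_pathELength (x : M) {C : ℝ≥0} {γ : ℝ → M}
    (hγ : ContMDiff 𝓘(ℝ, ℝ) I 1 γ)
    (hsource : ∀ t ∈ Icc (0 : ℝ) 1, γ t ∈ (chartAt H x).source)
    (hC : ∀ t ∈ Icc (0 : ℝ) 1, ∀ v : TangentSpace I (γ t),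
      ‖(mfderiv I 𝓘(ℝ, E) (extChartAt I x) (γ t) v : E)‖ₑ ≤ C * ‖v‖ₑ) :
    edist (extChartAt I x (γ 0)) (extChartAt I x (γ 1)) ≤ C * pathELength I γ 0 1 := by
  set η : ℝ → E := extChartAt I x ∘ γ with hη_def
  have hη : ContMDiffOn 𝓘(ℝ, ℝ) 𝓘(ℝ, E) 1 η (Icc 0 1) :=
    contMDiffOn_extChartAt.comp (I' := I) (t := (chartAt H x).source) hγ.contMDiffOn hsource
  calc edist (extChartAt I x (γ 0)) (extChartAt I x (γ 1)) = ‖η 1 - η 0‖ₑ := by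
        rw [edist_comm, edist_eq_enorm_sub]; rfl
    _ ≤ ∫⁻ t in Icc (0 : ℝ) 1, ‖derivWithin η (Icc 0 1) t‖ₑ :=
        enorm_sub_le_lintegral_derivWithin_Icc_of_contDiffOn_Icc
          (contMDiffOn_iff_contDiffOn.1 hη) zero_le_one
    _ = ∫⁻ t in Icc (0 : ℝ) 1, ‖(mfderivWithin 𝓘(ℝ, ℝ) 𝓘(ℝ, E) η (Icc 0 1) t 1 : E)‖ₑ := by
        simp_rw [← fderivWithin_derivWithin, mfderivWithin_eq_fderivWithin]
        rfl
    _ ≤ ∫⁻ t in Icc (0 : ℝ) 1, C * ‖mfderivWithin 𝓘(ℝ, ℝ) I γ (Icc 0 1) t 1‖ₑ := by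
        refine setLIntegral_mono' measurableSet_Icc fun t ht => ?_
        have hcomp : mfderivWithin 𝓘(ℝ, ℝ) 𝓘(ℝ, E) η (Icc 0 1) t =
            (mfderiv I 𝓘(ℝ, E) (extChartAt I x) (γ t)) ∘L
              (mfderivWithin 𝓘(ℝ, ℝ) I γ (Icc 0 1) t) := by
          apply mfderiv_comp_mfderivWithin
          · exact mdifferentiableAt_extChartAt (hsource t ht)
          · exact (hγ.mdifferentiable one_ne_zero).mdifferentiableOn _ ht
          · rw [uniqueMDiffWithinAt_iff_uniqueDiffWithinAt]
            exact uniqueDiffOn_Icc zero_lt_one _ ht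
        have hcomp_one : mfderivWithin 𝓘(ℝ, ℝ) 𝓘(ℝ, E) η (Icc 0 1) t 1 =
            (mfderiv I 𝓘(ℝ, E) (extChartAt I x) (γ t))
              (mfderivWithin 𝓘(ℝ, ℝ) I γ (Icc 0 1) t 1) :=
          congr($hcomp 1)
        rw [hcomp_one]
        exact hC t ht _
    _ = C * pathELength I γ 0 1 := by
        rw [lintegral_const_mul' _ _ ENNReal.coe_ne_top,
          pathELength_eq_lintegral_mfderivWithin_Icc]

theorem exists_lipschitzOnWith_extChartAt
    [IsContinuousRiemannianBundle E (fun x : M => TangentSpace I x)]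
    [IsRiemannianManifold I M] (x : M) :
    ∃ C : ℝ≥0, ∃ r > 0, ball x r ⊆ (chartAt H x).source ∧
      LipschitzOnWith C (extChartAt I x) (ball x r) := by
  obtain ⟨C, hC_pos, hC⟩ := eventually_enorm_mfderiv_extChartAt_apply_le I x
  obtain ⟨R, hR, hball⟩ := Metric.mem_nhds_iff.1
    (inter_mem hC (chart_source_mem_nhds H x))
  -- Since `R / 4 + R / 2 < R`, a curve of length below `R / 2` starting in the small ball stays
  -- where the derivative bound holds.
  refine ⟨C, R / 4, by positivity,
    fun y hy => (hball (ball_subset_ball (by linarith) hy)).2, fun y hy z hz => ?_⟩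
  have hyz : edist y z < ENNReal.ofReal (R / 2) := by
    rw [edist_lt_ofReal]
    rw [mem_ball] at hy hz
    linarith [dist_triangle_right y z x]
  have hbound : ∀ ρ, edist y z < ρ → ρ ≤ ENNReal.ofReal (R / 2) →
      edist (extChartAt I x y) (extChartAt I x z) ≤ C * ρ := by
    intro ρ hρ hρR
    rw [IsRiemannianManifold.out (I := I) y z] at hρ
    obtain ⟨γ, hγ0, hγ1, hγ, hlen, -⟩ :=
      exists_lt_locally_constant_of_riemannianEDist_lt hρ zero_lt_one
    have hmem : ∀ t ∈ Icc (0 : ℝ) 1, γ t ∈ ball x R := by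
      intro t ht
      have h1 : edist y (γ t) < ENNReal.ofReal (R / 2) := by
        rw [IsRiemannianManifold.out (I := I) y (γ t)]
        refine ((riemannianEDist_le_pathELength hγ.contMDiffOn hγ0 rfl ht.1).trans
          (pathELength_mono le_rfl ht.2)).trans_lt (hlen.trans_le hρR)
      rw [edist_lt_ofReal] at h1
      rw [mem_ball] at hy ⊢
      linarith [dist_triangle_left (γ t) x y]
    have := edist_extChartAt_le_pathELength I x hγ
      (fun t ht => (hball (hmem t ht)).2) (fun t ht => (hball (hmem t ht)).1)
    rw [hγ0, hγ1] at this
    exact this.trans (by gcongr)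
  have hdiv : edist (extChartAt I x y) (extChartAt I x z) / C ≤ edist y z := by
    refine le_of_forall_gt_imp_ge_of_dense fun ρ hρ => ?_
    refine le_trans ?_ (min_le_left ρ (ENNReal.ofReal (R / 2)))
    exact ENNReal.div_le_of_le_mul' (hbound _ (lt_min hρ hyz) (min_le_right _ _))
  rwa [ENNReal.div_le_iff' (by simp [hC_pos.ne']) (by simp)] at hdiv

end Chart

/-! ### Chart preimages of Lebesgue null sets -/

section NullSets

variable {p : ℕ} {M : Type*} [TopologicalSpace M] [ChartedSpace (EuclideanSpace ℝ (Fin p)) M]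

theorem measurableSet_source_inter_preimage_chartAt [MeasurableSpace M] [OpensMeasurableSpace M] (x₀ : M)
    {N : Set (EuclideanSpace ℝ (Fin p))} (hN : MeasurableSet N) :
    MeasurableSet ((chartAt (EuclideanSpace ℝ (Fin p)) x₀).source ∩
      chartAt (EuclideanSpace ℝ (Fin p)) x₀ ⁻¹' N) := by
  set e := chartAt (EuclideanSpace ℝ (Fin p)) x₀
  have h : Measurable (e.source.domRestrict e) :=
    (continuousOn_iff_continuous_domRestrict.1 e.continuousOn).measurable
  rw [← Subtype.image_preimage_coe]
  exact e.open_source.measurableSet.subtype_image (h hN)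

/-- The set is contained in the image of a null set under the differentiable transition map. -/
theorem volume_chart_transition_preimage_eq_zero [IsManifold (𝓡 p) 1 M] (x₀ x₁ : M)
    {N : Set (EuclideanSpace ℝ (Fin p))} (hN : volume N = 0) :
    volume ((chartAt (EuclideanSpace ℝ (Fin p)) x₁).symm ⁻¹'
      ((chartAt (EuclideanSpace ℝ (Fin p)) x₀).source ∩
        chartAt (EuclideanSpace ℝ (Fin p)) x₀ ⁻¹' N) ∩
      (chartAt (EuclideanSpace ℝ (Fin p)) x₁).target) = 0 := by
  set e₀ := chartAt (EuclideanSpace ℝ (Fin p)) x₀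
  set e₁ := chartAt (EuclideanSpace ℝ (Fin p)) x₁
  have hd : DifferentiableOn ℝ (e₁ ∘ e₀.symm) (e₀.target ∩ e₀.symm ⁻¹' e₁.source) := by
    rw [← mdifferentiableOn_iff_differentiableOn]
    exact (mdifferentiable_chart (I := 𝓡 p) x₁).1.comp
      ((mdifferentiable_chart (I := 𝓡 p) x₀).2.mono inter_subset_left) fun y hy => hy.2
  refine measure_mono_null ?_ (addHaar_image_eq_zero_of_differentiableOn_of_addHaar_eq_zero
    volume (hd.mono (inter_subset_right (s := N))) (measure_mono_null inter_subset_left hN))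
  rintro y ⟨⟨hy₀, hyN⟩, hy₁⟩
  refine ⟨e₀ (e₁.symm y), ⟨hyN, e₀.map_source hy₀, ?_⟩, ?_⟩
  · rw [mem_preimage, e₀.left_inv hy₀]
    exact e₁.map_target hy₁
  · rw [Function.comp_apply, e₀.left_inv hy₀, e₁.right_inv hy₁]

theorem riemannianVolume_source_inter_preimage_eq_zero
    [RiemannianBundle (fun x : M => TangentSpace (𝓡 p) x)] [MeasurableSpace M]
    [OpensMeasurableSpace M] [IsManifold (𝓡 p) 1 M] (x₀ : M) {N : Set (EuclideanSpace ℝ (Fin p))}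
    (hN : MeasurableSet N) (hN₀ : volume N = 0) :
    riemannianVolume p M ((chartAt (EuclideanSpace ℝ (Fin p)) x₀).source ∩
      chartAt (EuclideanSpace ℝ (Fin p)) x₀ ⁻¹' N) = 0 := by
  have hmeas := measurableSet_source_inter_preimage_chartAt x₀ hN
  refine Measure.iSup_apply_eq_zero hmeas fun x₁ => ?_
  rw [chartVolume]
  set κ := (volume.restrict (chartAt (EuclideanSpace ℝ (Fin p)) x₁).target).withDensity
    (fun y => ENNReal.ofReal (Real.sqrt (metricMatrix p x₁ y).det))
  -- `Measure.map` is `0` when the map is not a.e. measurable, so that case is harmless.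
  by_cases hae : AEMeasurable (chartAt (EuclideanSpace ℝ (Fin p)) x₁).symm κ
  · rw [Measure.map_apply_of_aemeasurable hae hmeas]
    refine withDensity_absolutelyContinuous _ _ ?_
    rw [Measure.restrict_apply' (chartAt _ x₁).open_target.measurableSet]
    exact volume_chart_transition_preimage_eq_zero x₀ x₁ hN₀
  · rw [Measure.map_of_not_aemeasurable hae]
    rfl

end NullSets

theorem isContinuousRiemannianBundle_of_isContMDiffRiemannianBundle {p : ℕ} {M : Type*}
    [TopologicalSpace M] [ChartedSpace (EuclideanSpace ℝ (Fin p)) M] [IsManifold (𝓡 p) ∞ M]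
    [RiemannianBundle (fun x : M => TangentSpace (𝓡 p) x)]
    [h : IsContMDiffRiemannianBundle (𝓡 p) ∞ (EuclideanSpace ℝ (Fin p))
      (fun x : M => TangentSpace (𝓡 p) x)] :
    IsContinuousRiemannianBundle (EuclideanSpace ℝ (Fin p))
      (fun x : M => TangentSpace (𝓡 p) x) := by
  obtain ⟨g, hg, hinner⟩ := h.exists_contMDiff
  exact ⟨g, hg.continuous, hinner⟩

end RiemannianOT

open RiemannianOT in
theorem exists_const_le_rmse (p : ℕ) (hp : 1 ≤ p)
    {M : Type*} [MetricSpace M] [CompactSpace M]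
    [ChartedSpace (EuclideanSpace ℝ (Fin p)) M] [IsManifold (𝓡 p) ∞ M]
    [RiemannianBundle (fun x : M => TangentSpace (𝓡 p) x)]
    [IsContMDiffRiemannianBundle (𝓡 p) ∞ (EuclideanSpace ℝ (Fin p))
      (fun x : M => TangentSpace (𝓡 p) x)]
    [IsRiemannianManifold (𝓡 p) M]
    [MeasurableSpace M] [BorelSpace M]
    (ν : Measure M) [IsProbabilityMeasure ν] (hν : ν ≪ riemannianVolume p M) :
    ∃ C : ℝ, 0 < C ∧ ∀ μ : Measure M, IsFiniteMeasure μ → ∀ S : M → M, Measurable S →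
      μ.map S = ν → ∀ m : ℕ, 1 ≤ m → ∀ T ∈ discreteOutputMaps m μ,
        C * (m : ℝ) ^ (-(1 / (p : ℝ))) ≤ rmse μ T S := by
  have := isContinuousRiemannianBundle_of_isContMDiffRiemannianBundle (p := p) (M := M)
  -- Every ball around a point of the support has positive mass, however small the Lipschitz radius.
  obtain ⟨x, hx⟩ := Measure.nonempty_support (IsProbabilityMeasure.ne_zero ν)
  obtain ⟨K, r, hr, hsource, hlip⟩ := exists_lipschitzOnWith_extChartAt (𝓡 p) x
  have hU := (isOpen_ball (x := x) (ε := r)).measurableSet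
  have hac : (ν.restrict (ball x r)).map (extChartAt (𝓡 p) x) ≪ volume := by
    refine Measure.AbsolutelyContinuous.mk fun N hN hN₀ => ?_
    rw [Measure.map_apply_of_aemeasurable (hlip.continuousOn.aemeasurable hU) hN,
      Measure.restrict_apply' hU]
    refine measure_mono_null ?_
      (hν (riemannianVolume_source_inter_preimage_eq_zero x hN hN₀))
    exact fun y hy => ⟨hsource hy.2, hy.1⟩
  have hfr : Module.finrank ℝ (EuclideanSpace ℝ (Fin p)) = p := by simp
  obtain ⟨κ, ε, hκ, hε, H⟩ := exists_pos_le_measure_far hU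
    ((Measure.mem_support_iff_forall x).1 hx _ (ball_mem_nhds x hr)).ne' hlip volume hac (by omega)
  rw [hfr] at H
  refine ⟨κ * Real.sqrt ε, by positivity, fun μ _ S hS hSν m hm T hT => ?_⟩
  rw [mul_right_comm]
  exact mul_sqrt_le_rmse hT.1 hS hSν (by positivity) (H m hm _ hT.2)

theorem theorem3p1 (p : ℕ) (hp : 1 ≤ p)
    {M : Type*} [MetricSpace M] [CompactSpace M] [ConnectedSpace M]
    [ChartedSpace (EuclideanSpace ℝ (Fin p)) M] [IsManifold (𝓡 p) ∞ M]
    [RiemannianBundle (fun x : M => TangentSpace (𝓡 p) x)]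
    [IsContMDiffRiemannianBundle (𝓡 p) ∞ (EuclideanSpace ℝ (Fin p))
      (fun x : M => TangentSpace (𝓡 p) x)]
    [IsRiemannianManifold (𝓡 p) M]
    [MeasurableSpace M] [BorelSpace M]
    (ν : Measure M) [IsProbabilityMeasure ν] (hν : ν ≪ RiemannianOT.riemannianVolume p M) :
    ∃ C : ℝ, 0 < C ∧
      ∀ μ : Measure M, IsProbabilityMeasure μ → μ ≪ RiemannianOT.riemannianVolume p M →
      ∀ Topt : M → M, RiemannianOT.IsOptimalTransportMap μ ν Topt →
      ∀ m : ℕ, 1 ≤ m →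
        (C * (m : ℝ) ^ (-(1 / (p : ℝ))) ≤
          ⨅ T : RiemannianOT.discreteOutputMaps m μ, RiemannianOT.rmse μ T Topt) ∧
        ∀ δ : ℝ, 0 < δ → ∀ T ∈ RiemannianOT.discreteOutputMaps m μ,
          RiemannianOT.rmse μ T Topt ≤ δ → (C / δ) ^ p ≤ (m : ℝ) := by
  obtain ⟨C, hC, H⟩ := exists_const_le_rmse p hp ν hν
  refine ⟨C, hC, fun μ _ _ Topt hT m hm => ⟨?_, fun δ hδ T hTm hle => ?_⟩⟩
  · have : Nonempty (RiemannianOT.discreteOutputMaps m μ) :=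
      (RiemannianOT.discreteOutputMaps_nonempty hm μ).to_subtype
    exact le_ciInf fun T => H μ inferInstance Topt hT.measurable hT.map_eq m hm T T.2
  · have hm0 : (0 : ℝ) < m := by exact_mod_cast hm
    have hbound := (H μ inferInstance Topt hT.measurable hT.map_eq m hm T hTm).trans hle
    have hdiv : C / δ ≤ (m : ℝ) ^ (1 / (p : ℝ)) := by
      rw [Real.rpow_neg hm0.le, ← div_eq_mul_inv, div_le_iff₀ (by positivity)] at hbound
      rw [div_le_iff₀ hδ, mul_comm]
      exact hbound
    calc (C / δ) ^ p ≤ ((m : ℝ) ^ (1 / (p : ℝ))) ^ p := by gcongr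
      _ = m := by
        rw [← Real.rpow_natCast, ← Real.rpow_mul hm0.le, one_div,
          inv_mul_cancel₀ (by positivity), Real.rpow_one]
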